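/- Let $n,k,p$ be non-negative integers, let $a_r<b_r$ be real numbers ($r=1,\dots,k$), let $\mathcal D=\prod_{r=1}^k[a_r,b_r]$, and let $u_{rj}$ ($r=1,\dots,k$, $j=1,\dots,p$) be non-negative integers. Consider the normal linear model in which, for a design $D=(\mathbf d_1,\dots,\mathbf d_n)\in\mathcal D^n$, the responses $y_1,\dots,y_n$ are independent given $\boldsymbol\theta\in\mathbb R^p$ and $\gamma>0$, with $y_i\sim \mathrm N\bigl(\sum_{j=1}^p f_j(\mathbf d_i)\theta_j,\ \gamma\bigr)$ and $f_j(\mathbf d)=\prod_{r=1}^k d_r^{u_{rj}}$. The scale $\gamma$ is treated in one of three ways: (i) $\gamma>0$ is known; (ii) $\gamma$ is a nuisance parameter, independent of $\boldsymbol\theta$ a priori, with inverse-gamma prior $\mathrm{IG}(s_1/2,s_2/2)$, $s_1,s_2>0$, and it is integrated out of the likelihood; (iii) $\gamma$ is unknown and of interest, and is appended to the parameter vector. Write $\boldsymbol\tau$ for the parameter vector ($\boldsymbol\tau=\boldsymbol\theta$ in (i) and (ii), $\boldsymbol\tau=(\boldsymbol\theta,\gamma)$ in (iii)), and let it have a prior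 probability density $\pi$ that is differentiable at almost every point at which it is positive. The expected Fisher information gain is $$U_{FIG}(D)=\mathrm E_{\mathbf y,\boldsymbol\tau\mid D}\Bigl[\bigl\|\nabla_{\boldsymbol\tau}\log\pi(\boldsymbol\tau\mid\mathbf y,D)\bigr\|_2^2-\bigl\|\nabla_{\boldsymbol\tau}\log\pi(\boldsymbol\tau)\bigr\|_2^2\Bigr],$$ and it is assumed that this expectation exists (the integrand is integrable) for every $D\in\mathcal D^n$. A design is FIG-optimal if it maximises $U_{FIG}$ over $\mathcal D^n$; its support points are the distinct vectors among $\mathbf d_1,\dots,\mathbf d_n$; it is under-supported if it has fewer than $p$ support points. Let $C$ be the number of $r\in\{1,\dots,k\}$ with $|a_r|=|b_r|$. Then: 1. There are designs $D\in\mathcal D^n$ with $|d_{ir}|=\max\{|a_r|,|b_r|\}$ for all $i=1,\dots,n$ and $r=1,\dots,k$, and every such design is FIG-optimal. 2. Conversely, if $D$ is FIG-optimal, then $|d_{ir}|=\max\{|a_r|,|b_r|\}$ for all $i$ and for every $r$ such that the variable $d_r$ occurs in the model (that is, $u_{rj}\ge 1$ for some $j$). 3. If every controllable variable occurs in the model,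 then every FIG-optimal design has at most $2^C$ support points, some FIG-optimal design has exactly $\min\{n,2^C\}$ support points, and if $p>2^C$ then all FIG-optimal designs are under-supported. -/

import Mathlib

open MeasureTheory ProbabilityTheory

namespace FIG

noncomputable section

/-! ### Fisher information gain for a general Bayesian model

The parameter is a vector `t : EuclideanSpace ℝ ι`, the response a vector `y : Fin n → ℝ`;
`lik t y` is the likelihood (density of `y` given `t`) and `prior` the prior density. -/

section General

variable {ι : Type} [Fintype ι] {n : ℕ}

/-- A prior probability density function with respect to Lebesgue measure, differentiable at
almost every point where it is positive (so that the gradient of the log prior makes sense almost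
surely). -/
structure IsPriorPDF (prior : EuclideanSpace ℝ ι → ℝ) : Prop where
  measurable : Measurable prior
  nonneg : ∀ t, 0 ≤ prior t
  lintegral_eq_one : ∫⁻ t, ENNReal.ofReal (prior t) = 1
  differentiable : ∀ᵐ t, 0 < prior t → DifferentiableAt ℝ prior t

/-- The posterior density at `t` given `y`, by Bayes' theorem. -/
def posterior (lik : EuclideanSpace ℝ ι → (Fin n → ℝ) → ℝ) (prior : EuclideanSpace ℝ ι → ℝ)
    (y : Fin n → ℝ) (t : EuclideanSpace ℝ ι) : ℝ :=
  lik t y * prior t / ∫ t', lik t' y * prior t'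

/-- The Fisher information gain utility: squared Euclidean length of the gradient of the log
posterior density minus that of the log prior density. -/
def utility (lik : EuclideanSpace ℝ ι → (Fin n → ℝ) → ℝ) (prior : EuclideanSpace ℝ ι → ℝ)
    (t : EuclideanSpace ℝ ι) (y : Fin n → ℝ) : ℝ :=
  ‖gradient (fun t' => Real.log (posterior lik prior y t')) t‖ ^ 2 -
    ‖gradient (fun t' => Real.log (prior t')) t‖ ^ 2

/-- The joint distribution of parameters and responses, with density `lik t y * prior t`. -/
def joint (lik : EuclideanSpace ℝ ι → (Fin n → ℝ) → ℝ) (prior : EuclideanSpace ℝ ι → ℝ) :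
    Measure (EuclideanSpace ℝ ι × (Fin n → ℝ)) :=
  (volume.prod volume).withDensity fun z => ENNReal.ofReal (lik z.1 z.2 * prior z.1)

/-- The expectation defining the expected Fisher information gain exists. -/
def HasExpected (lik : EuclideanSpace ℝ ι → (Fin n → ℝ) → ℝ)
    (prior : EuclideanSpace ℝ ι → ℝ) : Prop :=
  Integrable (fun z : EuclideanSpace ℝ ι × (Fin n → ℝ) => utility lik prior z.1 z.2)
    (joint lik prior)

/-- The expected Fisher information gain. -/
def expected (lik : EuclideanSpace ℝ ι → (Fin n → ℝ) → ℝ)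
    (prior : EuclideanSpace ℝ ι → ℝ) : ℝ :=
  ∫ z : EuclideanSpace ℝ ι × (Fin n → ℝ), utility lik prior z.1 z.2 ∂(joint lik prior)

end General

/-! ### The normal linear model with monomial regression functions

A design with `n` runs and `k` controllable variables is `D : Fin n → Fin k → ℝ`; the exponents
are `u r j` for the variable `r` and the regression function `j`. -/

section NormalLinear

variable {n k p : ℕ}

/-- The `j`-th regression function, a monomial in the controllable variables. -/
def regr (u : Fin k → Fin p → ℕ) (j : Fin p) (d : Fin k → ℝ) : ℝ :=
  ∏ r, d r ^ u r j

/-- The mean response at `d` when the regression coefficients are `θ`. -/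
def mean (u : Fin k → Fin p → ℕ) (θ : Fin p → ℝ) (d : Fin k → ℝ) : ℝ :=
  ∑ j, regr u j d * θ j

/-- Likelihood of independent normal responses with variance `γ`. -/
def normalLik (u : Fin k → Fin p → ℕ) (D : Fin n → Fin k → ℝ) (γ : ℝ) (θ : Fin p → ℝ)
    (y : Fin n → ℝ) : ℝ :=
  ∏ i, gaussianPDFReal (mean u θ (D i)) γ.toNNReal (y i)

/-- Density at `γ > 0` of the inverse-gamma distribution `IG(s₁/2, s₂/2)`. -/
def invGammaPDF (s₁ s₂ γ : ℝ) : ℝ :=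
  (s₂ / 2) ^ (s₁ / 2) / Real.Gamma (s₁ / 2) * γ ^ (-(s₁ / 2) - 1) * Real.exp (-s₂ / (2 * γ))

/-- Marginal likelihood when the variance is integrated out against `IG(s₁/2, s₂/2)`. -/
def marginalLik (u : Fin k → Fin p → ℕ) (D : Fin n → Fin k → ℝ) (s₁ s₂ : ℝ) (θ : Fin p → ℝ)
    (y : Fin n → ℝ) : ℝ :=
  ∫ γ in Set.Ioi (0 : ℝ), normalLik u D γ θ y * invGammaPDF s₁ s₂ γ

/-- The treatment of the variance `γ` together with the prior density:
* `known`: `γ` is known, `prior` is the prior density of the coefficients;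
* `nuisance`: `γ ~ IG(s₁/2, s₂/2)` independently of the coefficients and is integrated out,
  `prior` is the prior density of the coefficients;
* `ofInterest`: `γ` is a further unknown parameter (coordinate `Sum.inr ()`), `prior` is the joint
  prior density of coefficients and variance. -/
inductive Setting (p : ℕ) : Type
  | known (γ : ℝ) (prior : EuclideanSpace ℝ (Fin p) → ℝ)
  | nuisance (s₁ s₂ : ℝ) (prior : EuclideanSpace ℝ (Fin p) → ℝ)
  | ofInterest (prior : EuclideanSpace ℝ (Fin p ⊕ Unit) → ℝ)

/-- The constants are positive, the prior is a probability density, and the prior of a variance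
of interest lives on positive variances. -/
def Setting.Valid : Setting p → Prop
  | .known γ prior => 0 < γ ∧ IsPriorPDF prior
  | .nuisance s₁ s₂ prior => 0 < s₁ ∧ 0 < s₂ ∧ IsPriorPDF prior
  | .ofInterest prior => IsPriorPDF prior ∧ ∀ t, t (Sum.inr ()) ≤ 0 → prior t = 0

/-- The expected Fisher information gain of the design `D` exists. -/
def Setting.HasExpectedFIG (S : Setting p) (u : Fin k → Fin p → ℕ) (D : Fin n → Fin k → ℝ) :
    Prop :=
  match S with
  | .known γ prior => HasExpected (fun θ y => normalLik u D γ θ y) prior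
  | .nuisance s₁ s₂ prior => HasExpected (fun θ y => marginalLik u D s₁ s₂ θ y) prior
  | .ofInterest prior =>
      HasExpected (fun t y => normalLik u D (t (Sum.inr ())) (fun j => t (Sum.inl j)) y) prior

/-- The expected Fisher information gain of the design `D`. -/
def Setting.expectedFIG (S : Setting p) (u : Fin k → Fin p → ℕ) (D : Fin n → Fin k → ℝ) : ℝ :=
  match S with
  | .known γ prior => expected (fun θ y => normalLik u D γ θ y) prior
  | .nuisance s₁ s₂ prior => expected (fun θ y => marginalLik u D s₁ s₂ θ y) prior
  | .ofInterest prior =>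
      expected (fun t y => normalLik u D (t (Sum.inr ())) (fun j => t (Sum.inl j)) y) prior

/-- All designs with `n` runs over the box `∏ r, [a r, b r]`. -/
def designs (n : ℕ) (a b : Fin k → ℝ) : Set (Fin n → Fin k → ℝ) :=
  {D | ∀ i r, D i r ∈ Set.Icc (a r) (b r)}

/-- `D` maximises the expected Fisher information gain over all designs over the box. -/
def IsOptimal (S : Setting p) (u : Fin k → Fin p → ℕ) (a b : Fin k → ℝ)
    (D : Fin n → Fin k → ℝ) : Prop :=
  D ∈ designs n a b ∧ ∀ D' ∈ designs n a b, S.expectedFIG u D' ≤ S.expectedFIG u D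

/-- The number of support points (distinct runs) of a design. -/
def numSupport (D : Fin n → Fin k → ℝ) : ℕ :=
  (Set.range D).ncard

/-- A design is under-supported if it has fewer support points than there are coefficients. -/
def UnderSupported (p : ℕ) (D : Fin n → Fin k → ℝ) : Prop :=
  numSupport D < p

/-- The number `C` of variables whose interval `[a r, b r]` has `|a r| = |b r|`. -/
def numSymm (a b : Fin k → ℝ) : ℕ :=
  (Finset.univ.filter fun r => |a r| = |b r|).card

end NormalLinear

end

end FIG

namespace FIG

open Filter Topology

/-! ### Bayes' theorem, the score and Fubini for a general likelihood. -/

section General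

variable {ι : Type} [Fintype ι] {n : ℕ}
  {lik : EuclideanSpace ℝ ι → (Fin n → ℝ) → ℝ} {prior : EuclideanSpace ℝ ι → ℝ}

/-! Up to a term free of the parameter, the log posterior is log likelihood plus log prior. With `s`
the score and `g` the gradient of the log prior, the utility is therefore `‖s‖² + 2⟨s, g⟩`.

In all three settings the likelihood depends on the responses and the design only through the
residual sum of squares `q`. Write `X` for the matrix of monomials at the runs and `r` for the
residual vector. The coefficient block of the score is then `W(q) Xᵀr`, and given the parameter `r`
has a spherically symmetric law free of the design. Reflections kill the cross term with `g` and the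
mixed moments of `r`, while permutations equate the diagonal moments. So `W² ‖Xᵀr‖²` has expectation
`c · trace (XᵀX)` with `c > 0`. What a variance of interest adds depends on `q` and the parameter
only, so it does not see the design. Averaging over the prior gives `A · trace (XᵀX) + B` with `A >
0` (`exists_affine_expected`, specialised in `exists_affine_expectedFIG`).

The trace is a sum of squared monomials. It is largest when every coordinate has maximal modulus
(`sumSq_le`), and only then in the variables that occur (`abs_eq_max_of_sumSq_le`). The points with
all moduli maximal are counted by `card_corners`. -/

theorem IsPriorPDF.integrable (h : IsPriorPDF prior) : Integrable prior := by
  refine ⟨h.measurable.aestronglyMeasurable, ?_⟩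
  rw [hasFiniteIntegral_iff_ofReal (ae_of_all _ h.nonneg), h.lintegral_eq_one]
  exact ENNReal.one_lt_top

theorem IsPriorPDF.integral_eq_one (h : IsPriorPDF prior) : ∫ t, prior t = 1 := by
  rw [integral_eq_lintegral_of_nonneg_ae (ae_of_all _ h.nonneg) h.measurable.aestronglyMeasurable,
    h.lintegral_eq_one, ENNReal.toReal_one]

/-- A prior-weighted average of a function which is positive wherever the prior is. -/
theorem IsPriorPDF.integral_pos (h : IsPriorPDF prior) {G : EuclideanSpace ℝ ι → ℝ}
    (hG : Integrable fun t => prior t * G t) (hpos : ∀ t, 0 < prior t → 0 < G t) :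
    0 < ∫ t, prior t * G t := by
  have hnn : ∀ t, 0 ≤ prior t * G t := fun t => by
    rcases (h.nonneg t).eq_or_lt with h0 | h0
    · simp [← h0]
    · exact (mul_pos h0 (hpos t h0)).le
  rw [integral_pos_iff_support_of_nonneg hnn hG]
  have hsub : Function.support prior ⊆ Function.support fun t => prior t * G t := fun t ht => by
    have h0 : 0 < prior t := lt_of_le_of_ne (h.nonneg t) (Ne.symm ht)
    exact (mul_pos h0 (hpos t h0)).ne'
  refine lt_of_lt_of_le ?_ (measure_mono hsub)
  rw [← integral_pos_iff_support_of_nonneg h.nonneg h.integrable, h.integral_eq_one]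
  exact one_pos

/-- The utility in terms of the score `s`, the gradient of the log likelihood. -/
theorem utility_eq_of_hasGradientAt {t : EuclideanSpace ℝ ι} {y : Fin n → ℝ}
    {s : EuclideanSpace ℝ ι} (hprior : 0 < prior t) (hdiff : DifferentiableAt ℝ prior t)
    (hlik : ∀ᶠ t' in 𝓝 t, 0 < lik t' y)
    (hs : HasGradientAt (fun t' => Real.log (lik t' y)) s t)
    (hZ : 0 < ∫ t', lik t' y * prior t') :
    utility lik prior t y =
      ‖s‖ ^ 2 + 2 * inner ℝ s (gradient (fun t' => Real.log (prior t')) t) := by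
  have hg : HasGradientAt (fun t' => Real.log (prior t'))
      (gradient (fun t' => Real.log (prior t')) t) t :=
    (hdiff.log hprior.ne').hasGradientAt
  set g := gradient (fun t' => Real.log (prior t')) t with hgdef
  have hsum : HasGradientAt (fun t' => Real.log (posterior lik prior y t')) (s + g) t := by
    have h1 : HasGradientAt (fun t' => Real.log (lik t' y) + Real.log (prior t')
        - Real.log (∫ t', lik t' y * prior t')) (s + g) t := by
      rw [hasGradientAt_iff_hasFDerivAt] at hs hg ⊢
      rw [map_add]
      exact (hs.add hg).sub_const _
    refine h1.congr_of_eventuallyEq ?_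
    -- The logarithm splits only where likelihood and prior are both positive; near `t` the prior is
    -- positive by continuity.
    filter_upwards [hlik, hdiff.continuousAt.eventually (lt_mem_nhds hprior)] with t' h1 h2
    rw [posterior, Real.log_div (mul_pos h1 h2).ne' hZ.ne', Real.log_mul h1.ne' h2.ne']
  rw [utility, hsum.gradient, ← hgdef, norm_add_sq_real]
  ring

/-- Almost surely, the normalising constant of the posterior is positive. -/
theorem ae_evidence_pos (hprior : IsPriorPDF prior) (hmeas : Measurable (Function.uncurry lik))
    (hnonneg : ∀ t y, 0 ≤ lik t y) (hpos : ∀ t, 0 < prior t → ∀ y, 0 < lik t y) {M : ℝ}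
    (hint : ∀ t, 0 < prior t → Integrable (lik t))
    (hM : ∀ t, 0 < prior t → ∫ y, lik t y = M) :
    ∀ᵐ y, 0 < ∫ t, lik t y * prior t := by
  have hj : Integrable (fun z : EuclideanSpace ℝ ι × (Fin n → ℝ) => lik z.1 z.2 * prior z.1)
      (volume.prod volume) := by
    have hm : Measurable fun z : EuclideanSpace ℝ ι × (Fin n → ℝ) => lik z.1 z.2 * prior z.1 :=
      hmeas.mul (hprior.measurable.comp measurable_fst)
    rw [integrable_prod_iff hm.aestronglyMeasurable]
    constructor
    · refine ae_of_all _ fun t => ?_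
      rcases (hprior.nonneg t).eq_or_lt with h0 | h0
      · simp [← h0]
      · simpa only using (hint t h0).mul_const (prior t)
    · refine (hprior.integrable.const_mul M).congr (ae_of_all _ fun t => ?_)
      dsimp only
      rcases (hprior.nonneg t).eq_or_lt with h0 | h0
      · simp [← h0]
      · simp_rw [Real.norm_of_nonneg (mul_nonneg (hnonneg t _) (hprior.nonneg t))]
        rw [integral_mul_const, hM t h0]
  filter_upwards [hj.prod_left_ae] with y hy
  have := hprior.integral_pos (G := fun t => lik t y) (by simpa only [mul_comm] using hy)
    (fun t ht => hpos t ht y)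
  simpa only [mul_comm] using this

/-- Fubini for the expected Fisher information gain. -/
theorem expected_eq_integral_prior (hprior : IsPriorPDF prior)
    (hmeas : Measurable (Function.uncurry lik)) (hnonneg : ∀ t y, 0 ≤ lik t y)
    (hE : HasExpected lik prior) :
    (∀ᵐ t, 0 < prior t → Integrable fun y => lik t y * utility lik prior t y) ∧
      Integrable (fun t => prior t * ∫ y, lik t y * utility lik prior t y) ∧
      expected lik prior = ∫ t, prior t * ∫ y, lik t y * utility lik prior t y := by
  have hm : Measurable fun z : EuclideanSpace ℝ ι × (Fin n → ℝ) =>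
      ENNReal.ofReal (lik z.1 z.2 * prior z.1) :=
    (hmeas.mul (hprior.measurable.comp measurable_fst)).ennreal_ofReal
  have hint : Integrable (fun z : EuclideanSpace ℝ ι × (Fin n → ℝ) =>
      prior z.1 * (lik z.1 z.2 * utility lik prior z.1 z.2)) (volume.prod volume) := by
    have := (integrable_withDensity_iff_integrable_smul' hm
      (ae_of_all _ fun _ => ENNReal.ofReal_lt_top)).1 hE
    refine this.congr (ae_of_all _ fun z => ?_)
    dsimp only
    rw [ENNReal.toReal_ofReal (mul_nonneg (hnonneg _ _) (hprior.nonneg _)), smul_eq_mul]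
    ring
  refine ⟨?_, ?_, ?_⟩
  · filter_upwards [hint.prod_right_ae] with t ht h0
    refine (ht.const_mul (prior t)⁻¹).congr (ae_of_all _ fun y => ?_)
    dsimp only
    rw [inv_mul_cancel_left₀ h0.ne']
  · simpa only [integral_const_mul] using hint.integral_prod_left
  · rw [expected, joint, integral_withDensity_eq_integral_toReal_smul hm
      (ae_of_all _ fun _ => ENNReal.ofReal_lt_top)]
    simp_rw [← integral_const_mul]
    rw [← integral_prod _ hint]
    refine integral_congr_ae (ae_of_all _ fun z => ?_)
    dsimp only
    rw [ENNReal.toReal_ofReal (mul_nonneg (hnonneg _ _) (hprior.nonneg _)), smul_eq_mul]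
    ring

/-- If the integrals over `t` of `prior t * (G t * τ D + H t)` exist for all `D`, they are an
increasing affine function of `τ D`. -/
theorem exists_affine_of_integrable {α : Type*} (hprior : IsPriorPDF prior) (Δ : Set α)
    (τ : α → ℝ) {G H : EuclideanSpace ℝ ι → ℝ} (hG : ∀ t, 0 < prior t → 0 < G t)
    (hint : ∀ D ∈ Δ, Integrable fun t => prior t * (G t * τ D + H t)) :
    ∃ A B : ℝ, 0 < A ∧ ∀ D ∈ Δ, ∫ t, prior t * (G t * τ D + H t) = A * τ D + B := by
  -- If `τ` takes two values, subtracting the two integrands shows that `prior * G` is integrable,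
  -- and then so is `prior * H`. Otherwise the two need not be integrable separately, but `τ` is
  -- constant and any positive slope will do.
  by_cases hτ : ∃ D₀ ∈ Δ, ∃ D₁ ∈ Δ, τ D₀ ≠ τ D₁
  · obtain ⟨D₀, h₀, D₁, h₁, hne⟩ := hτ
    have hne' : τ D₀ - τ D₁ ≠ 0 := sub_ne_zero.2 hne
    have hGi : Integrable fun t => prior t * G t := by
      refine (((hint D₀ h₀).sub (hint D₁ h₁)).mul_const (τ D₀ - τ D₁)⁻¹).congr
        (ae_of_all _ fun t => ?_)
      simp only [Pi.sub_apply]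
      field_simp
      ring
    have hHi : Integrable fun t => prior t * H t := by
      refine ((hint D₀ h₀).sub (hGi.mul_const (τ D₀))).congr (ae_of_all _ fun t => ?_)
      simp only [Pi.sub_apply]
      ring
    refine ⟨∫ t, prior t * G t, ∫ t, prior t * H t, hprior.integral_pos hGi hG, fun D _ => ?_⟩
    rw [← integral_mul_const, ← integral_add (hGi.mul_const _) hHi]
    refine integral_congr_ae (ae_of_all _ fun t => ?_)
    dsimp only
    ring
  · push Not at hτ
    rcases Δ.eq_empty_or_nonempty with rfl | ⟨D₀, h₀⟩
    · exact ⟨1, 0, one_pos, by simp⟩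
    · refine ⟨1, (∫ t, prior t * (G t * τ D₀ + H t)) - τ D₀, one_pos, fun D hD => ?_⟩
      rw [hτ D hD D₀ h₀]
      ring

end General

end FIG

namespace FIG

/-! ### Moments under spherically symmetric weights on `ℝⁿ`. -/

section Radial

variable {n : ℕ}

/-- Flipping the sign of the coordinate `i`. -/
theorem measurePreserving_flip (i : Fin n) :
    MeasurePreserving (fun (r : Fin n → ℝ) l => if l = i then -r l else r l) := by
  refine volume_preserving_pi (f := fun l x => if l = i then -x else x) fun l => ?_
  by_cases h : l = i
  · simpa [h] using Measure.measurePreserving_neg (volume : Measure ℝ)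
  · simpa [h] using! MeasurePreserving.id (volume : Measure ℝ)

theorem integral_flip (i : Fin n) (f : (Fin n → ℝ) → ℝ) :
    ∫ r : Fin n → ℝ, f (fun l => if l = i then -r l else r l) = ∫ r, f r := by
  refine (measurePreserving_flip i).integral_comp ?_ f
  refine (MeasurableEquiv.measurableEmbedding
    ⟨(Function.Involutive.toPerm (fun (r : Fin n → ℝ) l => if l = i then -r l else r l) ?_),
      (measurePreserving_flip i).measurable, (measurePreserving_flip i).measurable⟩)
  intro r
  ext l
  by_cases h : l = i <;> simp [h]

theorem integral_perm (σ : Equiv.Perm (Fin n)) (f : (Fin n → ℝ) → ℝ) :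
    ∫ r : Fin n → ℝ, f (fun l => r (σ l)) = ∫ r, f r :=
  (volume_preserving_arrowCongr' σ.symm (MeasurableEquiv.refl ℝ)
    (MeasurePreserving.id _)).integral_comp' f

/-- The reflection preserves volume and the sum of squares, so the integral equals its own negative.
The change of variables needs no integrability. -/
theorem integral_radial_mul_odd (F : ℝ → ℝ) {h : (Fin n → ℝ) → ℝ} (i : Fin n)
    (hodd : ∀ r, h (fun l => if l = i then -r l else r l) = -h r) :
    ∫ r : Fin n → ℝ, F (∑ l, r l ^ 2) * h r = 0 := by
  have := integral_flip i fun r : Fin n → ℝ => F (∑ l, r l ^ 2) * h r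
  simp only [hodd, mul_neg, integral_neg, ite_pow, neg_sq, ite_self] at this
  linarith

theorem integral_radial_mul_sq_eq (F : ℝ → ℝ) (i l : Fin n) :
    ∫ r : Fin n → ℝ, F (∑ m, r m ^ 2) * r i ^ 2 =
      ∫ r : Fin n → ℝ, F (∑ m, r m ^ 2) * r l ^ 2 := by
  rw [← integral_perm (Equiv.swap i l) fun r : Fin n → ℝ => F (∑ m, r m ^ 2) * r l ^ 2]
  refine integral_congr_ae (ae_of_all _ fun r => ?_)
  dsimp only
  rw [Equiv.sum_comp (Equiv.swap i l) (fun m => r m ^ 2), Equiv.swap_apply_right]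

theorem integrable_radial_mul_mul {F : ℝ → ℝ} (hF : Measurable F) (hpos : ∀ q, 0 ≤ q → 0 < F q)
    (hint : ∀ i, Integrable fun r : Fin n → ℝ => F (∑ m, r m ^ 2) * r i ^ 2) (i l : Fin n) :
    Integrable fun r : Fin n → ℝ => F (∑ m, r m ^ 2) * (r i * r l) := by
  refine ((hint i).add (hint l)).mono' (by fun_prop) (ae_of_all _ fun r => ?_)
  have h0 := (hpos (∑ m, r m ^ 2) (Finset.sum_nonneg fun m _ => sq_nonneg _)).le
  rw [norm_mul, Real.norm_of_nonneg h0, Pi.add_apply, ← mul_add]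
  refine mul_le_mul_of_nonneg_left ?_ h0
  rw [Real.norm_eq_abs, abs_le]
  constructor <;> nlinarith [sq_nonneg (r i + r l), sq_nonneg (r i - r l)]

/-- Second moments of linear forms under a spherically symmetric weight. -/
theorem exists_radial_second_moment {F : ℝ → ℝ} (hF : Measurable F)
    (hpos : ∀ q, 0 ≤ q → 0 < F q)
    (hint : ∀ i, Integrable fun r : Fin n → ℝ => F (∑ m, r m ^ 2) * r i ^ 2) :
    ∃ c : ℝ, 0 < c ∧ ∀ x : Fin n → ℝ,
      Integrable (fun r : Fin n → ℝ => F (∑ m, r m ^ 2) * (∑ i, x i * r i) ^ 2) ∧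
      ∫ r : Fin n → ℝ, F (∑ m, r m ^ 2) * (∑ i, x i * r i) ^ 2 = c * ∑ i, x i ^ 2 := by
  rcases isEmpty_or_nonempty (Fin n) with hn | ⟨⟨i₀⟩⟩
  · exact ⟨1, one_pos, fun x => by simp⟩
  have hmul := integrable_radial_mul_mul hF hpos hint
  -- One diagonal moment serves for all coordinates, by exchangeability. It is positive because the
  -- integrand is positive on the nonempty open set `r i₀ ≠ 0`.
  refine ⟨∫ r : Fin n → ℝ, F (∑ m, r m ^ 2) * r i₀ ^ 2, ?_, fun x => ?_⟩
  · have hnn : ∀ r : Fin n → ℝ, 0 < F (∑ m, r m ^ 2) := fun r =>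
      hpos _ (Finset.sum_nonneg fun m _ => sq_nonneg _)
    rw [integral_pos_iff_support_of_nonneg
      (fun r => mul_nonneg (hnn r).le (sq_nonneg _)) (hint i₀)]
    have hsub : {r : Fin n → ℝ | r i₀ ≠ 0} ⊆
        Function.support fun r : Fin n → ℝ => F (∑ m, r m ^ 2) * r i₀ ^ 2 := fun r hr =>
      mul_ne_zero (hnn r).ne' (pow_ne_zero 2 hr)
    refine lt_of_lt_of_le ?_ (measure_mono hsub)
    refine IsOpen.measure_pos _ ?_ ⟨fun _ => 1, one_ne_zero⟩
    exact isOpen_ne_fun (continuous_apply i₀) continuous_const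
  · have hexp : (fun r : Fin n → ℝ => F (∑ m, r m ^ 2) * (∑ i, x i * r i) ^ 2) =
        fun r => ∑ i, ∑ l, x i * x l * (F (∑ m, r m ^ 2) * (r i * r l)) := by
      ext r
      rw [sq, Finset.sum_mul_sum, Finset.mul_sum]
      refine Finset.sum_congr rfl fun i _ => ?_
      rw [Finset.mul_sum]
      exact Finset.sum_congr rfl fun l _ => by ring
    have hterm : ∀ i l, Integrable fun r : Fin n → ℝ =>
        x i * x l * (F (∑ m, r m ^ 2) * (r i * r l)) := fun i l => (hmul i l).const_mul _
    rw [hexp]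
    refine ⟨integrable_finsetSum _ fun i _ => integrable_finsetSum _ fun l _ => hterm i l, ?_⟩
    rw [integral_finsetSum _ fun i _ => integrable_finsetSum _ fun l _ => hterm i l,
      Finset.mul_sum]
    refine Finset.sum_congr rfl fun i _ => ?_
    -- Only the diagonal survives: for `l ≠ i` the product `r i * r l` is odd in `r i`.
    rw [integral_finsetSum _ fun l _ => hterm i l, Finset.sum_eq_single i]
    · rw [integral_const_mul, mul_comm]
      simp_rw [← sq]
      rw [integral_radial_mul_sq_eq F i i₀]
    · intro l _ hl
      rw [integral_const_mul, integral_radial_mul_odd F i, mul_zero]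
      intro r
      simp [hl]
    · simp

/-- First moments of linear forms under a spherically symmetric weight. -/
theorem integral_radial_mul_linear {F : ℝ → ℝ}
    (hint : ∀ i, Integrable fun r : Fin n → ℝ => F (∑ m, r m ^ 2) * r i) (x : Fin n → ℝ) :
    Integrable (fun r : Fin n → ℝ => F (∑ m, r m ^ 2) * ∑ i, x i * r i) ∧
      ∫ r : Fin n → ℝ, F (∑ m, r m ^ 2) * ∑ i, x i * r i = 0 := by
  have hexp : (fun r : Fin n → ℝ => F (∑ m, r m ^ 2) * ∑ i, x i * r i) =
      fun r => ∑ i, x i * (F (∑ m, r m ^ 2) * r i) := by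
    ext r
    rw [Finset.mul_sum]
    exact Finset.sum_congr rfl fun i _ => by ring
  rw [hexp]
  refine ⟨integrable_finsetSum _ fun i _ => (hint i).const_mul _, ?_⟩
  rw [integral_finsetSum _ fun i _ => (hint i).const_mul _]
  refine Finset.sum_eq_zero fun i _ => ?_
  rw [integral_const_mul, integral_radial_mul_odd F i (by simp), mul_zero]

end Radial

end FIG

namespace FIG

open Filter Topology

/-! ### The expected gain as an affine function of `trace (XᵀX)`. -/

section Affine

variable {ι : Type} [Fintype ι] {n k p : ℕ} {prior : EuclideanSpace ℝ ι → ℝ}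

/-- The design criterion `trace (Xᵀ X)`. -/
noncomputable def sumSq (u : Fin k → Fin p → ℕ) (D : Fin n → Fin k → ℝ) : ℝ :=
  ∑ i, ∑ j, regr u j (D i) ^ 2

/-- Under a spherically symmetric error density `Φ t (∑ r²)`, the conditional expectation given `t`
of a quadratic expression in the residuals. -/
theorem exists_conditional_expectation (u : Fin k → Fin p → ℕ) {Φ W : ℝ → ℝ}
    (hΦ : Measurable Φ) (hW : Measurable W) (hΦpos : ∀ q, 0 ≤ q → 0 < Φ q)
    (hWpos : ∀ q, 0 ≤ q → 0 < W q) (hint : Integrable fun r : Fin n → ℝ => Φ (∑ m, r m ^ 2))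
    (hint₂ : ∀ i, Integrable fun r : Fin n → ℝ =>
      Φ (∑ m, r m ^ 2) * (W (∑ m, r m ^ 2) * r i) ^ 2) :
    ∃ c : ℝ, 0 < c ∧ ∀ (D : Fin n → Fin k → ℝ) (g : Fin p → ℝ) (R : ℝ → ℝ),
      (Integrable fun r : Fin n → ℝ => Φ (∑ m, r m ^ 2) *
        (W (∑ m, r m ^ 2) ^ 2 * ∑ j, (∑ i, regr u j (D i) * r i) ^ 2 +
          2 * W (∑ m, r m ^ 2) * ∑ j, (∑ i, regr u j (D i) * r i) * g j + R (∑ m, r m ^ 2))) →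
      ∫ r : Fin n → ℝ, Φ (∑ m, r m ^ 2) *
        (W (∑ m, r m ^ 2) ^ 2 * ∑ j, (∑ i, regr u j (D i) * r i) ^ 2 +
          2 * W (∑ m, r m ^ 2) * ∑ j, (∑ i, regr u j (D i) * r i) * g j + R (∑ m, r m ^ 2)) =
      c * sumSq u D + ∫ r : Fin n → ℝ, Φ (∑ m, r m ^ 2) * R (∑ m, r m ^ 2) := by
  obtain ⟨c, hc, hmom⟩ := exists_radial_second_moment (n := n) (F := fun q => Φ q * W q ^ 2)
    (by fun_prop) (fun q hq => mul_pos (hΦpos q hq) (pow_pos (hWpos q hq) 2))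
    (fun i => (hint₂ i).congr (ae_of_all _ fun r => by dsimp only; ring))
  have hlin := fun x : Fin n → ℝ => integral_radial_mul_linear (F := fun q => Φ q * W q)
    (fun i => by
      -- Domination by `|x| ≤ 1 + x²` with `x = W * r i`.
      refine (hint.add (hint₂ i)).mono' (by fun_prop) (ae_of_all _ fun r => ?_)
      have h0 := (hΦpos (∑ m, r m ^ 2) (Finset.sum_nonneg fun m _ => sq_nonneg _)).le
      rw [mul_assoc, norm_mul, Real.norm_of_nonneg h0, Pi.add_apply, ← mul_one_add]
      refine mul_le_mul_of_nonneg_left ?_ h0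
      rw [Real.norm_eq_abs, abs_le]
      constructor <;> nlinarith [sq_nonneg (W (∑ m, r m ^ 2) * r i + 1),
        sq_nonneg (W (∑ m, r m ^ 2) * r i - 1)]) x
  refine ⟨c, hc, fun D g R hR => ?_⟩
  set f₁ : (Fin n → ℝ) → ℝ := fun r => ∑ j,
    Φ (∑ m, r m ^ 2) * W (∑ m, r m ^ 2) ^ 2 * (∑ i, regr u j (D i) * r i) ^ 2 with hf₁
  set f₂ : (Fin n → ℝ) → ℝ := fun r => ∑ j,
    2 * g j * (Φ (∑ m, r m ^ 2) * W (∑ m, r m ^ 2) * ∑ i, regr u j (D i) * r i) with hf₂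
  set f₃ : (Fin n → ℝ) → ℝ := fun r => Φ (∑ m, r m ^ 2) * R (∑ m, r m ^ 2) with hf₃
  have hexp : (fun r : Fin n → ℝ => Φ (∑ m, r m ^ 2) *
      (W (∑ m, r m ^ 2) ^ 2 * ∑ j, (∑ i, regr u j (D i) * r i) ^ 2 +
        2 * W (∑ m, r m ^ 2) * ∑ j, (∑ i, regr u j (D i) * r i) * g j + R (∑ m, r m ^ 2))) =
      f₁ + f₂ + f₃ := by
    ext r
    simp only [hf₁, hf₂, hf₃, Pi.add_apply, mul_add, Finset.mul_sum (s := (Finset.univ : Finset (Fin p)))]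
    congr 2 <;> exact Finset.sum_congr rfl fun j _ => by ring
  have i₁ : Integrable f₁ := integrable_finsetSum _ fun j _ => (hmom _).1
  have i₂ : Integrable f₂ := integrable_finsetSum _ fun j _ => (hlin _).1.const_mul _
  rw [hexp] at hR ⊢
  -- Integrability of the `R` term is not assumed; it is inherited from the whole, since the other
  -- two terms are integrable.
  have i₃ : Integrable f₃ := by simpa using hR.sub (i₁.add i₂)
  have e₁ : ∫ r, f₁ r = c * sumSq u D := by
    rw [hf₁, integral_finsetSum _ fun j _ => (hmom _).1, sumSq, Finset.sum_comm, Finset.mul_sum]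
    exact Finset.sum_congr rfl fun j _ => (hmom _).2
  have e₂ : ∫ r, f₂ r = 0 := by
    rw [hf₂, integral_finsetSum _ fun j _ => (hlin _).1.const_mul _]
    refine Finset.sum_eq_zero fun j _ => ?_
    rw [integral_const_mul, (hlin _).2, mul_zero]
  rw [integral_add' (i₁.add i₂) i₃, integral_add' i₁ i₂, e₁, e₂, add_zero]

/-- The expected Fisher information gain as a function of the design, for a likelihood which is a
function of the residual sum of squares. -/
theorem exists_affine_expected (hprior : IsPriorPDF prior) (u : Fin k → Fin p → ℕ)
    (Δ : Set (Fin n → Fin k → ℝ))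
    {lik : (Fin n → Fin k → ℝ) → EuclideanSpace ℝ ι → (Fin n → ℝ) → ℝ}
    (θ : EuclideanSpace ℝ ι → Fin p → ℝ) (emb : Fin p → ι)
    {Φ W : EuclideanSpace ℝ ι → ℝ → ℝ} (R : EuclideanSpace ℝ ι → ℝ → EuclideanSpace ℝ ι → ℝ)
    {M : ℝ}
    (hlik : ∀ D t, 0 < prior t → ∀ y, lik D t y = Φ t (∑ i, (y i - mean u (θ t) (D i)) ^ 2))
    (hmeas : ∀ D, Measurable (Function.uncurry (lik D))) (hnonneg : ∀ D t y, 0 ≤ lik D t y)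
    (hΦ : ∀ t, 0 < prior t → Measurable (Φ t)) (hW : ∀ t, 0 < prior t → Measurable (W t))
    (hΦpos : ∀ t, 0 < prior t → ∀ q, 0 ≤ q → 0 < Φ t q)
    (hWpos : ∀ t, 0 < prior t → ∀ q, 0 ≤ q → 0 < W t q)
    (hint : ∀ t, 0 < prior t → Integrable fun r : Fin n → ℝ => Φ t (∑ m, r m ^ 2))
    (hint₂ : ∀ t, 0 < prior t → ∀ i, Integrable fun r : Fin n → ℝ =>
      Φ t (∑ m, r m ^ 2) * (W t (∑ m, r m ^ 2) * r i) ^ 2)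
    (hM : ∀ t, 0 < prior t → ∫ r : Fin n → ℝ, Φ t (∑ m, r m ^ 2) = M)
    (hlikpos : ∀ D t, 0 < prior t → ∀ y, ∀ᶠ t' in 𝓝 t, 0 < lik D t' y)
    (hscore : ∀ D t, 0 < prior t → ∀ y, ∀ q, q = ∑ i, (y i - mean u (θ t) (D i)) ^ 2 →
      ∃ s, HasGradientAt (fun t' => Real.log (lik D t' y)) s t ∧ ∀ g, ‖s‖ ^ 2 + 2 * inner ℝ s g =
        W t q ^ 2 * ∑ j, (∑ i, regr u j (D i) * (y i - mean u (θ t) (D i))) ^ 2 +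
          2 * W t q * ∑ j, (∑ i, regr u j (D i) * (y i - mean u (θ t) (D i))) * g (emb j) +
          R t q g)
    (hE : ∀ D ∈ Δ, HasExpected (lik D) prior) :
    ∃ A B : ℝ, 0 < A ∧ ∀ D ∈ Δ, expected (lik D) prior = A * sumSq u D + B := by
  -- The constant is fixed for each `t` before any design is chosen, so that all designs share one
  -- slope. Its value `0` off the support of the prior is immaterial.
  have hc : ∀ t, ∃ c : ℝ, 0 < prior t → 0 < c ∧ _ := fun t => by
    by_cases ht : 0 < prior t
    · obtain ⟨c, hc⟩ := exists_conditional_expectation u (hΦ t ht) (hW t ht) (hΦpos t ht)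
        (hWpos t ht) (hint t ht) (hint₂ t ht)
      exact ⟨c, fun _ => hc⟩
    · exact ⟨0, fun h => absurd h ht⟩
  choose c hc using hc
  set g : EuclideanSpace ℝ ι → EuclideanSpace ℝ ι := gradient fun t' => Real.log (prior t')
  set H : EuclideanSpace ℝ ι → ℝ := fun t =>
    ∫ r : Fin n → ℝ, Φ t (∑ m, r m ^ 2) * R t (∑ m, r m ^ 2) (g t)
  have key : ∀ D ∈ Δ, Integrable (fun t => prior t * (c t * sumSq u D + H t)) ∧
      expected (lik D) prior = ∫ t, prior t * (c t * sumSq u D + H t) := by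
    intro D hD
    obtain ⟨h₁, h₂, h₃⟩ := expected_eq_integral_prior hprior (hmeas D) (hnonneg D) (hE D hD)
    -- The design shifts the error density by the mean vector; translation invariance of volume
    -- removes this shift from every integral over `y`.
    have hres : ∀ t, 0 < prior t →
        lik D t = fun y => (fun r : Fin n → ℝ => Φ t (∑ m, r m ^ 2))
          (y - fun i => mean u (θ t) (D i)) := fun t ht => by
      ext y
      simpa using hlik D t ht y
    have hZ := ae_evidence_pos hprior (hmeas D) (hnonneg D)
      (fun t ht y => (hlikpos D t ht y).self_of_nhds) (M := M)
      (fun t ht => by rw [hres t ht]; exact (hint t ht).comp_sub_right _)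
      (fun t ht => by
        rw [hres t ht, integral_sub_right_eq_self
          (fun r : Fin n → ℝ => Φ t (∑ m, r m ^ 2)), hM t ht])
    have hae : (fun t => prior t * ∫ y, lik D t y * utility (lik D) prior t y) =ᵐ[volume]
        fun t => prior t * (c t * sumSq u D + H t) := by
      filter_upwards [h₁, hprior.differentiable] with t ht₁ htd
      rcases (hprior.nonneg t).eq_or_lt with h0 | h0
      · simp [← h0]
      congr 1
      set K : (Fin n → ℝ) → ℝ := fun r => Φ t (∑ m, r m ^ 2) *
        (W t (∑ m, r m ^ 2) ^ 2 * ∑ j, (∑ i, regr u j (D i) * r i) ^ 2 +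
          2 * W t (∑ m, r m ^ 2) * ∑ j, (∑ i, regr u j (D i) * r i) * g t (emb j) +
          R t (∑ m, r m ^ 2) (g t))
      have hK : (fun y => lik D t y * utility (lik D) prior t y) =ᵐ[volume]
          fun y => K (y - fun i => mean u (θ t) (D i)) := by
        filter_upwards [hZ] with y hy
        obtain ⟨s, hs, hsq⟩ := hscore D t h0 y _ rfl
        rw [utility_eq_of_hasGradientAt h0 (htd h0) (hlikpos D t h0 y) hs hy, hsq, hlik D t h0]
        rfl
      rw [integral_congr_ae hK, integral_sub_right_eq_self K]
      have hKi : Integrable K := by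
        have := ((integrable_congr hK).1 (ht₁ h0)).comp_add_right fun i => mean u (θ t) (D i)
        simpa using this
      exact (hc t h0).2 D (fun j => g t (emb j)) (fun q => R t q (g t)) hKi
    exact ⟨h₂.congr hae, h₃.trans (integral_congr_ae hae)⟩
  obtain ⟨A, B, hA, hAB⟩ := exists_affine_of_integrable hprior Δ (sumSq u)
    (fun t ht => (hc t ht).1) fun D hD => (key D hD).1
  exact ⟨A, B, hA, fun D hD => (key D hD).2.trans (hAB D hD)⟩

end Affine

end FIG

namespace FIG

open Filter Topology

/-! ### Gradients of the log likelihood. -/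

section Score

variable {ι : Type} [Fintype ι] {n k p : ℕ}

theorem hasGradientAt_of_inner_eq {f : EuclideanSpace ℝ ι → ℝ} {s t : EuclideanSpace ℝ ι}
    {L : EuclideanSpace ℝ ι →L[ℝ] ℝ} (hf : HasFDerivAt f L t) (hs : ∀ h, inner ℝ s h = L h) :
    HasGradientAt f s t := by
  rw [hasGradientAt_iff_hasFDerivAt]
  convert! hf using 1
  ext h
  simpa using hs h

/-- The derivative of the residual sum of squares. -/
theorem hasFDerivAt_rss (u : Fin k → Fin p → ℕ) (D : Fin n → Fin k → ℝ) (emb : Fin p → ι)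
    (y : Fin n → ℝ) (t : EuclideanSpace ℝ ι) :
    HasFDerivAt (fun t' : EuclideanSpace ℝ ι =>
        ∑ i, (y i - mean u (fun j => t' (emb j)) (D i)) ^ 2)
      (∑ j, (-2 * ∑ i, regr u j (D i) * (y i - mean u (fun j => t (emb j)) (D i))) •
        (EuclideanSpace.proj (emb j) : EuclideanSpace ℝ ι →L[ℝ] ℝ)) t := by
  have hmean : ∀ i, HasFDerivAt
      (fun t' : EuclideanSpace ℝ ι => mean u (fun j => t' (emb j)) (D i))
      (∑ j, regr u j (D i) • (EuclideanSpace.proj (emb j) : EuclideanSpace ℝ ι →L[ℝ] ℝ)) t :=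
    fun i => HasFDerivAt.fun_sum fun j _ =>
      ((EuclideanSpace.proj (emb j) : EuclideanSpace ℝ ι →L[ℝ] ℝ).hasFDerivAt).const_mul _
  have hsum := HasFDerivAt.fun_sum (u := Finset.univ)
    fun i _ => ((hmean i).const_sub (y i)).pow 2
  convert! hsum using 1
  ext h
  simp only [_root_.sum_apply, _root_.smul_apply, smul_eq_mul,
    _root_.neg_apply, Finset.mul_sum, Finset.sum_mul, mul_neg]
  rw [Finset.sum_comm]
  simp only [← Finset.sum_neg_distrib]
  refine Finset.sum_congr rfl fun i _ => ?_
  refine Finset.sum_congr rfl fun j _ => ?_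
  simp
  ring

/-- The score when the log likelihood is a function of the residual sum of squares. -/
theorem exists_score_of_hasDerivAt (u : Fin k → Fin p → ℕ) (D : Fin n → Fin k → ℝ)
    (y : Fin n → ℝ) (t : EuclideanSpace ℝ (Fin p)) {f : EuclideanSpace ℝ (Fin p) → ℝ}
    {F : ℝ → ℝ} {w : ℝ}
    (hf : ∀ t' : EuclideanSpace ℝ (Fin p), f t' = F (∑ i, (y i - mean u t' (D i)) ^ 2))
    (hF : HasDerivAt F (-w / 2) (∑ i, (y i - mean u t (D i)) ^ 2)) :
    ∃ s, HasGradientAt f s t ∧ ∀ g : EuclideanSpace ℝ (Fin p), ‖s‖ ^ 2 + 2 * inner ℝ s g =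
      w ^ 2 * ∑ j, (∑ i, regr u j (D i) * (y i - mean u t (D i))) ^ 2 +
        2 * w * ∑ j, (∑ i, regr u j (D i) * (y i - mean u t (D i))) * g j + 0 := by
  obtain rfl : f = _ := funext hf
  -- The factor `-w / 2` cancels the `-2` in the derivative of the residual sum of squares, leaving
  -- `w Xᵀr`.
  refine ⟨WithLp.toLp 2 fun j => w * ∑ i, regr u j (D i) * (y i - mean u t (D i)),
    hasGradientAt_of_inner_eq (hF.comp_hasFDerivAt t (hasFDerivAt_rss u D id y t)) fun h => ?_,
    fun g => ?_⟩
  · simp only [PiLp.inner_apply, _root_.smul_apply, _root_.sum_apply,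
      smul_eq_mul, Finset.mul_sum (s := (Finset.univ : Finset (Fin p)))]
    refine Finset.sum_congr rfl fun j _ => ?_
    simp
    ring
  · simp only [EuclideanSpace.real_norm_sq_eq, PiLp.inner_apply,
      Finset.mul_sum (s := (Finset.univ : Finset (Fin p))), add_zero]
    congr 1 <;> refine Finset.sum_congr rfl fun j _ => ?_
    · ring
    · simp
      ring

/-- The score of the regression coefficients and the variance in the normal linear model. -/
theorem exists_score_normal (u : Fin k → Fin p → ℕ) (D : Fin n → Fin k → ℝ)
    (y : Fin n → ℝ) (t : EuclideanSpace ℝ (Fin p ⊕ Unit)) (ht : 0 < t (Sum.inr ()))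
    {f : EuclideanSpace ℝ (Fin p ⊕ Unit) → ℝ} {F : ℝ → ℝ} {F' : ℝ} {q : ℝ}
    (hq : q = ∑ i, (y i - mean u (fun j => t (Sum.inl j)) (D i)) ^ 2)
    (hf : f =ᶠ[𝓝 t] fun t' => F (t' (Sum.inr ())) -
      (2 * t' (Sum.inr ()))⁻¹ * ∑ i, (y i - mean u (fun j => t' (Sum.inl j)) (D i)) ^ 2)
    (hF : HasDerivAt F F' (t (Sum.inr ()))) :
    ∃ s, HasGradientAt f s t ∧ ∀ g : EuclideanSpace ℝ (Fin p ⊕ Unit),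
      ‖s‖ ^ 2 + 2 * inner ℝ s g =
      (t (Sum.inr ()))⁻¹ ^ 2 *
          ∑ j, (∑ i, regr u j (D i) * (y i - mean u (fun j => t (Sum.inl j)) (D i))) ^ 2 +
        2 * (t (Sum.inr ()))⁻¹ *
          ∑ j, (∑ i, regr u j (D i) * (y i - mean u (fun j => t (Sum.inl j)) (D i))) *
            g (Sum.inl j) +
        ((F' + q / (2 * t (Sum.inr ()) ^ 2)) ^ 2 +
          2 * (F' + q / (2 * t (Sum.inr ()) ^ 2)) * g (Sum.inr ())) := by
  set γ := t (Sum.inr ()) with hγ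
  have hproj : HasFDerivAt (fun t' : EuclideanSpace ℝ (Fin p ⊕ Unit) => t' (Sum.inr ()))
      (EuclideanSpace.proj (Sum.inr ()) : EuclideanSpace ℝ (Fin p ⊕ Unit) →L[ℝ] ℝ) t :=
    (EuclideanSpace.proj (Sum.inr ()) : EuclideanSpace ℝ (Fin p ⊕ Unit) →L[ℝ] ℝ).hasFDerivAt
  have hinv : HasDerivAt (fun x : ℝ => (2 * x)⁻¹) (-2 / (2 * γ) ^ 2) γ := by
    convert! ((hasDerivAt_id γ).const_mul 2).inv (by simpa using ht.ne') using 1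
    simp
  -- The formula for `f` is required only near `t`, because the normal log density has this form
  -- only at positive variances.
  have hd := ((HasDerivAt.comp_hasFDerivAt t hF hproj).sub
    ((HasDerivAt.comp_hasFDerivAt t hinv hproj).mul
      (hasFDerivAt_rss u D Sum.inl y t))).congr_of_eventuallyEq hf
  refine ⟨WithLp.toLp 2 (Sum.elim
      (fun j => γ⁻¹ * ∑ i, regr u j (D i) * (y i - mean u (fun j => t (Sum.inl j)) (D i)))
      fun _ => F' + q / (2 * γ ^ 2)), hasGradientAt_of_inner_eq hd fun h => ?_, fun g => ?_⟩
  · simp only [PiLp.inner_apply, _root_.smul_apply, _root_.sum_apply,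
      _root_.sub_apply, _root_.add_apply, Fintype.sum_sum_type,
      Sum.elim_inl, Sum.elim_inr, smul_eq_mul, Function.comp_apply, ← hγ, ← hq,
      Finset.mul_sum (s := (Finset.univ : Finset (Fin p)))]
    have hsum : ∀ c : Fin p → ℝ, ∑ j, (2 * γ)⁻¹ * (-2 * c j * h (Sum.inl j)) =
        -∑ j, h (Sum.inl j) * (γ⁻¹ * c j) := fun c => by
      rw [← Finset.sum_neg_distrib]
      refine Finset.sum_congr rfl fun j _ => ?_
      rw [mul_inv]
      ring
    simp only [PiLp.proj_apply, RCLike.inner_apply, conj_trivial, hsum,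
      Finset.univ_unique, Finset.sum_singleton, PUnit.default_eq_unit]
    have hq' : ∀ x : ℝ, q * (-2 / (2 * γ) ^ 2 * x) = -(x * (q / (2 * γ ^ 2))) := fun x => by
      field_simp
    rw [hq']
    ring
  · simp only [EuclideanSpace.real_norm_sq_eq, PiLp.inner_apply, Fintype.sum_sum_type,
      Finset.mul_sum (s := (Finset.univ : Finset (Fin p))), Sum.elim_inl, Sum.elim_inr]
    simp only [RCLike.inner_apply, conj_trivial, Finset.univ_unique, Finset.sum_singleton,
      PUnit.default_eq_unit, mul_pow, mul_add, Finset.mul_sum (s := (Finset.univ : Finset (Fin p)))]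
    have hsum : ∀ c : Fin p → ℝ, ∑ j, 2 * (g (Sum.inl j) * (γ⁻¹ * c j)) =
        ∑ j, 2 * γ⁻¹ * (c j * g (Sum.inl j)) := fun c =>
      Finset.sum_congr rfl fun j _ => by ring
    rw [hsum]
    ring

end Score

end FIG

namespace FIG

open Filter Topology

/-! ### Variance known, or a parameter of interest. -/

section Normal

variable {n k p : ℕ}

/-- The joint density of `n` independent centred normal variables with variance `γ`, as a function
of the sum of squares. -/
noncomputable def normalRadial (n : ℕ) (γ q : ℝ) : ℝ :=
  (√(2 * Real.pi * γ))⁻¹ ^ n * Real.exp (-(2 * γ)⁻¹ * q)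

theorem prod_gaussianPDFReal_eq {γ : ℝ} (hγ : 0 < γ) (m y : Fin n → ℝ) :
    ∏ i, gaussianPDFReal (m i) γ.toNNReal (y i) = normalRadial n γ (∑ i, (y i - m i) ^ 2) := by
  simp only [gaussianPDFReal, Real.coe_toNNReal _ hγ.le, Finset.prod_mul_distrib,
    Finset.prod_const, Finset.card_univ, Fintype.card_fin, ← Real.exp_sum, normalRadial]
  congr 2
  rw [Finset.mul_sum]
  exact Finset.sum_congr rfl fun i _ => by ring

theorem normalLik_eq_normalRadial (u : Fin k → Fin p → ℕ) (D : Fin n → Fin k → ℝ) {γ : ℝ}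
    (hγ : 0 < γ) (θ : Fin p → ℝ) (y : Fin n → ℝ) :
    normalLik u D γ θ y = normalRadial n γ (∑ i, (y i - mean u θ (D i)) ^ 2) :=
  prod_gaussianPDFReal_eq hγ _ y

theorem normalRadial_pos {γ : ℝ} (hγ : 0 < γ) (q : ℝ) : 0 < normalRadial n γ q := by
  unfold normalRadial
  positivity

theorem measurable_normalRadial (γ : ℝ) : Measurable (normalRadial n γ) := by
  unfold normalRadial
  fun_prop

theorem log_normalRadial {γ : ℝ} (hγ : 0 < γ) (q : ℝ) :
    Real.log (normalRadial n γ q) =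
      Real.log ((√(2 * Real.pi * γ))⁻¹ ^ n) - (2 * γ)⁻¹ * q := by
  rw [normalRadial, Real.log_mul (by positivity) (Real.exp_pos _).ne', Real.log_exp]
  ring

theorem normalRadial_sum_sq {γ : ℝ} (hγ : 0 < γ) (r : Fin n → ℝ) :
    normalRadial n γ (∑ m, r m ^ 2) = ∏ i, gaussianPDFReal 0 γ.toNNReal (r i) := by
  simp [prod_gaussianPDFReal_eq hγ (fun _ => 0) r]

theorem integrable_normalRadial {γ : ℝ} (hγ : 0 < γ) :
    Integrable fun r : Fin n → ℝ => normalRadial n γ (∑ m, r m ^ 2) := by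
  simp_rw [normalRadial_sum_sq hγ]
  exact Integrable.fintype_prod fun _ => integrable_gaussianPDFReal _ _

theorem integral_normalRadial {γ : ℝ} (hγ : 0 < γ) :
    ∫ r : Fin n → ℝ, normalRadial n γ (∑ m, r m ^ 2) = 1 := by
  simp_rw [normalRadial_sum_sq hγ]
  rw [integral_fintype_prod_volume_eq_pow, integral_gaussianPDFReal_eq_one _ (by simpa using hγ),
    one_pow]

theorem integrable_normalRadial_mul_sq {γ : ℝ} (hγ : 0 < γ) (i : Fin n) :
    Integrable fun r : Fin n → ℝ => normalRadial n γ (∑ m, r m ^ 2) * r i ^ 2 := by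
  -- The integrand is a product over coordinates, with a second-moment factor at `i` and plain
  -- Gaussian densities elsewhere.
  have h : ∀ l, Integrable fun x : ℝ =>
      gaussianPDFReal 0 γ.toNNReal x * (if l = i then x ^ 2 else 1) := fun l => by
    by_cases hl : l = i
    · have h2 := (memLp_two_iff_integrable_sq (by fun_prop)).1
        (memLp_id_gaussianReal (μ := 0) (v := γ.toNNReal) 2)
      rw [gaussianReal_of_var_ne_zero _ (by simpa using hγ),
        integrable_withDensity_iff_integrable_smul' (measurable_gaussianPDF _ _)
          (ae_of_all _ fun _ => gaussianPDF_lt_top)] at h2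
      simpa [hl, toReal_gaussianPDF] using h2
    · simpa [hl] using integrable_gaussianPDFReal 0 γ.toNNReal
  refine (Integrable.fintype_prod h).congr (ae_of_all _ fun r => ?_)
  dsimp only
  rw [normalRadial_sum_sq hγ, Finset.prod_mul_distrib]
  simp

theorem measurable_normalLik (u : Fin k → Fin p → ℕ) (D : Fin n → Fin k → ℝ) :
    Measurable fun z : ℝ × (Fin p → ℝ) × (Fin n → ℝ) => normalLik u D z.1 z.2.1 z.2.2 := by
  unfold normalLik mean
  refine Finset.measurable_prod _ fun i _ => ?_
  exact measurable_uncurry_gaussianPDFReal.comp (by fun_prop :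
    Measurable fun z : ℝ × (Fin p → ℝ) × (Fin n → ℝ) =>
      (∑ j, regr u j (D i) * z.2.1 j, z.1.toNNReal, z.2.2 i))

theorem normalLik_nonneg (u : Fin k → Fin p → ℕ) (D : Fin n → Fin k → ℝ) (γ : ℝ)
    (θ : Fin p → ℝ) (y : Fin n → ℝ) : 0 ≤ normalLik u D γ θ y :=
  Finset.prod_nonneg fun _ _ => gaussianPDFReal_nonneg _ _ _

theorem exists_affine_known {γ : ℝ} (hγ : 0 < γ) {prior : EuclideanSpace ℝ (Fin p) → ℝ}
    (hprior : IsPriorPDF prior) (u : Fin k → Fin p → ℕ) (Δ : Set (Fin n → Fin k → ℝ))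
    (hE : ∀ D ∈ Δ, HasExpected (fun θ y => normalLik u D γ θ y) prior) :
    ∃ A B : ℝ, 0 < A ∧ ∀ D ∈ Δ,
      expected (fun θ y => normalLik u D γ θ y) prior = A * sumSq u D + B := by
  refine exists_affine_expected hprior u Δ (lik := fun D θ y => normalLik u D γ θ y)
    (fun t => t) id (Φ := fun _ => normalRadial n γ) (W := fun _ _ => γ⁻¹) (fun _ _ _ => 0) (M := 1)
    ?_ ?_ ?_ ?_ ?_ ?_ ?_ ?_ ?_ ?_ ?_ ?_ hE
  · exact fun D t _ y => normalLik_eq_normalRadial u D hγ t y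
  · exact fun D => (measurable_normalLik u D).comp
      (by fun_prop : Measurable fun z : EuclideanSpace ℝ (Fin p) × (Fin n → ℝ) =>
        (γ, (z.1 : Fin p → ℝ), z.2))
  · exact fun D t y => normalLik_nonneg u D γ t y
  · exact fun _ _ => measurable_normalRadial γ
  · exact fun _ _ => measurable_const
  · exact fun _ _ q _ => normalRadial_pos hγ q
  · exact fun _ _ _ _ => inv_pos.2 hγ
  · exact fun _ _ => integrable_normalRadial hγ
  · intro _ _ i
    refine ((integrable_normalRadial_mul_sq hγ i).mul_const (γ⁻¹ ^ 2)).congr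
      (ae_of_all _ fun r => ?_)
    dsimp only
    ring
  · exact fun _ _ => integral_normalRadial hγ
  · refine fun D t _ y => Eventually.of_forall fun t' => ?_
    rw [normalLik_eq_normalRadial u D hγ]
    exact normalRadial_pos hγ _
  · rintro D t _ y q rfl
    refine exists_score_of_hasDerivAt u D y t (F := fun q => Real.log (normalRadial n γ q))
      (fun t' => by rw [normalLik_eq_normalRadial u D hγ]) ?_
    simp_rw [log_normalRadial hγ]
    convert! ((hasDerivAt_id _).const_mul (2 * γ)⁻¹).const_sub _ using 1
    rw [mul_inv]
    ring

theorem exists_affine_ofInterest {prior : EuclideanSpace ℝ (Fin p ⊕ Unit) → ℝ}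
    (hprior : IsPriorPDF prior) (hsupp : ∀ t, t (Sum.inr ()) ≤ 0 → prior t = 0)
    (u : Fin k → Fin p → ℕ) (Δ : Set (Fin n → Fin k → ℝ))
    (hE : ∀ D ∈ Δ, HasExpected
      (fun t y => normalLik u D (t (Sum.inr ())) (fun j => t (Sum.inl j)) y) prior) :
    ∃ A B : ℝ, 0 < A ∧ ∀ D ∈ Δ,
      expected (fun t y => normalLik u D (t (Sum.inr ())) (fun j => t (Sum.inl j)) y) prior =
        A * sumSq u D + B := by
  have hpos : ∀ t, 0 < prior t → 0 < t (Sum.inr ()) := fun t ht => by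
    by_contra h
    exact ht.ne' (hsupp t (not_lt.1 h))
  have hnhds : ∀ t : EuclideanSpace ℝ (Fin p ⊕ Unit), 0 < t (Sum.inr ()) →
      ∀ᶠ t' in 𝓝 t, 0 < t' (Sum.inr ()) := fun t ht =>
    (by fun_prop : Continuous fun t' : EuclideanSpace ℝ (Fin p ⊕ Unit) =>
      t' (Sum.inr ())).continuousAt.eventually (lt_mem_nhds ht)
  refine exists_affine_expected hprior u Δ
    (lik := fun D t y => normalLik u D (t (Sum.inr ())) (fun j => t (Sum.inl j)) y)
    (fun t j => t (Sum.inl j)) Sum.inl (Φ := fun t => normalRadial n (t (Sum.inr ())))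
    (W := fun t _ => (t (Sum.inr ()))⁻¹)
    -- This is the contribution of the variance coordinate. The derivative of the log normalising
    -- constant need not be evaluated, as it is the same for all designs.
    (fun t q g =>
      (deriv (fun γ => Real.log ((√(2 * Real.pi * γ))⁻¹ ^ n)) (t (Sum.inr ())) +
          q / (2 * t (Sum.inr ()) ^ 2)) ^ 2 +
        2 * (deriv (fun γ => Real.log ((√(2 * Real.pi * γ))⁻¹ ^ n)) (t (Sum.inr ())) +
          q / (2 * t (Sum.inr ()) ^ 2)) * g (Sum.inr ())) (M := 1)
    ?_ ?_ ?_ ?_ ?_ ?_ ?_ ?_ ?_ ?_ ?_ ?_ hE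
  · exact fun D t ht y => normalLik_eq_normalRadial u D (hpos t ht) _ y
  · exact fun D => (measurable_normalLik u D).comp
      (by fun_prop : Measurable fun z : EuclideanSpace ℝ (Fin p ⊕ Unit) × (Fin n → ℝ) =>
        (z.1 (Sum.inr ()), (fun j => z.1 (Sum.inl j) : Fin p → ℝ), z.2))
  · exact fun D t y => normalLik_nonneg u D _ _ y
  · exact fun _ _ => measurable_normalRadial _
  · exact fun _ _ => measurable_const
  · exact fun t ht q _ => normalRadial_pos (hpos t ht) q
  · exact fun t ht _ _ => inv_pos.2 (hpos t ht)
  · exact fun t ht => integrable_normalRadial (hpos t ht)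
  · intro t ht i
    refine ((integrable_normalRadial_mul_sq (hpos t ht) i).mul_const
      ((t (Sum.inr ()))⁻¹ ^ 2)).congr (ae_of_all _ fun r => ?_)
    dsimp only
    ring
  · exact fun t ht => integral_normalRadial (hpos t ht)
  · intro D t ht y
    filter_upwards [hnhds t (hpos t ht)] with t' ht'
    rw [normalLik_eq_normalRadial u D ht']
    exact normalRadial_pos ht' _
  · rintro D t ht y q hq
    refine exists_score_normal u D y t (hpos t ht) hq
      (F := fun γ => Real.log ((√(2 * Real.pi * γ))⁻¹ ^ n)) ?_ (DifferentiableAt.hasDerivAt ?_)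
    · filter_upwards [hnhds t (hpos t ht)] with t' ht'
      rw [normalLik_eq_normalRadial u D ht', log_normalRadial ht']
    · have := hpos t ht
      have h1 : 2 * Real.pi * t (Sum.inr ()) ≠ 0 := by positivity
      have h2 : √(2 * Real.pi * t (Sum.inr ())) ≠ 0 := by positivity
      have h3 : DifferentiableAt ℝ (fun γ : ℝ => 2 * Real.pi * γ) (t (Sum.inr ())) := by fun_prop
      exact (((h3.sqrt h1).fun_inv h2).fun_pow n).log (by positivity)

end Normal

/-! ### Variance integrated out against an inverse-gamma prior. -/

section Marginal

variable {n k p : ℕ}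

/-- The substitution `γ ↦ γ⁻¹` turns this into the Gamma integral. -/
theorem integral_rpow_mul_exp_neg_div {α β : ℝ} (hα : 0 < α) (hβ : 0 < β) :
    ∫ γ in Set.Ioi (0 : ℝ), γ ^ (-α - 1) * Real.exp (-β / γ) =
      β ^ (-α) * Real.Gamma α := by
  rw [Real.rpow_neg hβ.le, ← Real.inv_rpow hβ.le, ← one_div,
    ← Real.integral_rpow_mul_exp_neg_mul_Ioi hα hβ,
    ← integral_comp_rpow_Ioi (fun x : ℝ => x ^ (α - 1) * Real.exp (-(β * x)))
      (by norm_num : (-1 : ℝ) ≠ 0)]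
  refine setIntegral_congr_fun measurableSet_Ioi fun γ hγ => ?_
  have h0 : (0 : ℝ) < γ := hγ
  rw [← Real.rpow_mul h0.le, smul_eq_mul, abs_neg, abs_one, one_mul, ← mul_assoc,
    ← Real.rpow_add h0, Real.rpow_neg_one]
  congr 2
  · ring
  · rw [neg_div, div_eq_mul_inv]

/-- Conjugacy: the normal factor `γ ^ (-n/2) * exp (-q / (2γ))` turns the prior into an
inverse-gamma kernel with shape `(s₁ + n) / 2` and scale `(s₂ + q) / 2`. The result is a
multivariate t kernel. -/
theorem marginalLik_eq {s₁ s₂ : ℝ} (h₁ : 0 < s₁) (h₂ : 0 < s₂) (n : ℕ) :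
    ∃ K : ℝ, 0 < K ∧ ∀ (u : Fin k → Fin p → ℕ) (D : Fin n → Fin k → ℝ) (θ : Fin p → ℝ)
      (y : Fin n → ℝ), marginalLik u D s₁ s₂ θ y =
        K * (s₂ + ∑ i, (y i - mean u θ (D i)) ^ 2) ^ (-((s₁ + n) / 2)) := by
  have hα : 0 < (s₁ + n) / 2 := by positivity
  have hΓ := Real.Gamma_pos_of_pos hα
  have hΓ' := Real.Gamma_pos_of_pos (half_pos h₁)
  refine ⟨(√(2 * Real.pi))⁻¹ ^ n * ((s₂ / 2) ^ (s₁ / 2) / Real.Gamma (s₁ / 2)) *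
    ((1 / 2) ^ (-((s₁ + n) / 2)) * Real.Gamma ((s₁ + n) / 2)), by positivity,
    fun u D θ y => ?_⟩
  set q := ∑ i, (y i - mean u θ (D i)) ^ 2 with hq
  have hq0 : 0 ≤ q := Finset.sum_nonneg fun _ _ => sq_nonneg _
  have hβ : 0 < (s₂ + q) / 2 := by positivity
  have key : ∀ γ ∈ Set.Ioi (0 : ℝ), normalLik u D γ θ y * invGammaPDF s₁ s₂ γ =
      (√(2 * Real.pi))⁻¹ ^ n * ((s₂ / 2) ^ (s₁ / 2) / Real.Gamma (s₁ / 2)) *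
        (γ ^ (-((s₁ + n) / 2) - 1) * Real.exp (-((s₂ + q) / 2) / γ)) := fun γ hγ => by
    have h0 : (0 : ℝ) < γ := hγ
    have e₁ : (√(2 * Real.pi * γ))⁻¹ ^ n = (√(2 * Real.pi))⁻¹ ^ n * γ ^ (-(n / 2 : ℝ)) := by
      rw [Real.sqrt_mul (by positivity), mul_inv, mul_pow, Real.sqrt_eq_rpow γ,
        ← Real.rpow_neg h0.le, ← Real.rpow_natCast (γ ^ (-(1 / 2) : ℝ)), ← Real.rpow_mul h0.le]
      congr 2
      ring
    have e₂ : γ ^ (-((s₁ + n) / 2) - 1) = γ ^ (-(n / 2 : ℝ)) * γ ^ (-(s₁ / 2) - 1) := by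
      rw [← Real.rpow_add h0]
      congr 1
      ring
    have e₃ : Real.exp (-((s₂ + q) / 2) / γ) =
        Real.exp (-(2 * γ)⁻¹ * q) * Real.exp (-s₂ / (2 * γ)) := by
      rw [← Real.exp_add]
      congr 1
      field_simp
      ring
    rw [normalLik_eq_normalRadial u D h0, normalRadial, invGammaPDF, e₁, e₂, e₃]
    ring
  rw [marginalLik, setIntegral_congr_fun measurableSet_Ioi key, integral_const_mul,
    integral_rpow_mul_exp_neg_div hα hβ, div_eq_mul_one_div (s₂ + q),
    Real.mul_rpow (by positivity) (by positivity)]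
  ring

/-- Comparison with a power of `1 + ‖r‖²`, integrable since `s₁ + n` exceeds the dimension `n`. The
norm is the sup norm, so `‖r‖² ≤ ∑ r²`, and `min s₂ 1` absorbs the difference between `s₂` and `1`.
-/
theorem integrable_add_sum_sq_rpow {s₁ s₂ : ℝ} (h₁ : 0 < s₁) (h₂ : 0 < s₂) :
    Integrable fun r : Fin n → ℝ => (s₂ + ∑ m, r m ^ 2) ^ (-((s₁ + n) / 2)) := by
  have hb := integrable_rpow_neg_one_add_norm_sq (E := Fin n → ℝ) (μ := volume) (r := s₁ + n)
    (by simpa using h₁)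
  set m := min s₂ 1 with hm
  have hm0 : 0 < m := lt_min h₂ one_pos
  refine (hb.const_mul (m ^ (-((s₁ + n) / 2)))).mono'
    (by fun_prop : Measurable _).aestronglyMeasurable (ae_of_all _ fun r => ?_)
  have hs : 0 ≤ ∑ m, r m ^ 2 := Finset.sum_nonneg fun _ _ => sq_nonneg _
  have hr : ‖r‖ ^ 2 ≤ ∑ m, r m ^ 2 := by
    refine (Real.le_sqrt (norm_nonneg _) hs).1 ((pi_norm_le_iff_of_nonneg (Real.sqrt_nonneg _)).2
      fun i => ?_)
    rw [Real.norm_eq_abs]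
    exact Real.abs_le_sqrt (Finset.single_le_sum (f := fun m => r m ^ 2)
      (fun _ _ => sq_nonneg _) (Finset.mem_univ i))
  rw [Real.norm_of_nonneg (by positivity), neg_div, ← Real.mul_rpow hm0.le (by positivity)]
  refine Real.rpow_le_rpow_of_nonpos (by positivity) ?_ (by
    have : (0 : ℝ) ≤ n := n.cast_nonneg
    linarith)
  have h3 : m ≤ s₂ := min_le_left _ _
  have h4 : m ≤ 1 := min_le_right _ _
  nlinarith [sq_nonneg ‖r‖]

theorem exists_affine_nuisance {s₁ s₂ : ℝ} (h₁ : 0 < s₁) (h₂ : 0 < s₂)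
    {prior : EuclideanSpace ℝ (Fin p) → ℝ}
    (hprior : IsPriorPDF prior) (u : Fin k → Fin p → ℕ) (Δ : Set (Fin n → Fin k → ℝ))
    (hE : ∀ D ∈ Δ, HasExpected (fun θ y => marginalLik u D s₁ s₂ θ y) prior) :
    ∃ A B : ℝ, 0 < A ∧ ∀ D ∈ Δ,
      expected (fun θ y => marginalLik u D s₁ s₂ θ y) prior = A * sumSq u D + B := by
  obtain ⟨K, hK, hlik⟩ := marginalLik_eq (k := k) (p := p) h₁ h₂ n
  have hint := (integrable_add_sum_sq_rpow (n := n) h₁ h₂).const_mul K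
  refine exists_affine_expected hprior u Δ (lik := fun D θ y => marginalLik u D s₁ s₂ θ y)
    (fun t => t) id (Φ := fun _ q => K * (s₂ + q) ^ (-((s₁ + n) / 2)))
    -- This is `-2` times the derivative in `q` of the log of the t kernel.
    (W := fun _ q => (s₁ + n) / (s₂ + q)) (fun _ _ _ => 0)
    -- Only independence of the parameter is needed, so the total mass is not computed.
    (M := ∫ r : Fin n → ℝ, K * (s₂ + ∑ m, r m ^ 2) ^ (-((s₁ + n) / 2)))
    ?_ ?_ ?_ ?_ ?_ ?_ ?_ ?_ ?_ ?_ ?_ ?_ hE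
  · exact fun D t _ y => hlik u D t y
  · intro D
    have : Function.uncurry (fun (θ : EuclideanSpace ℝ (Fin p)) y => marginalLik u D s₁ s₂ θ y) =
        fun z => K * (s₂ + ∑ i, (z.2 i - mean u z.1 (D i)) ^ 2) ^ (-((s₁ + n) / 2)) := by
      ext z
      exact hlik u D z.1 z.2
    rw [this]
    unfold mean
    fun_prop
  · intro D t y
    have hs : 0 ≤ ∑ i, (y i - mean u t (D i)) ^ 2 := Finset.sum_nonneg fun _ _ => sq_nonneg _
    rw [hlik]
    positivity
  · intro _ _
    fun_prop
  · intro _ _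
    fun_prop
  · intro _ _ q hq
    positivity
  · intro _ _ q hq
    positivity
  · exact fun _ _ => hint
  · intro _ _ i
    -- From `s₂ * r i ^ 2 ≤ s₂ * q ≤ (s₂ + q)²`, the weighted square `(W * r i)²` is bounded. Hence
    -- no second moment of the t law is required, and small `s₁` is allowed.
    refine (hint.mul_const ((s₁ + n) ^ 2 / s₂)).mono' (by fun_prop) (ae_of_all _ fun r => ?_)
    have hs : 0 ≤ ∑ m, r m ^ 2 := Finset.sum_nonneg fun _ _ => sq_nonneg _
    have hi : r i ^ 2 ≤ ∑ m, r m ^ 2 := Finset.single_le_sum (f := fun m => r m ^ 2)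
      (fun _ _ => sq_nonneg _) (Finset.mem_univ i)
    set q := ∑ m, r m ^ 2 with hq
    rw [Real.norm_of_nonneg (by positivity)]
    refine mul_le_mul_of_nonneg_left ?_ (by positivity)
    rw [mul_pow, div_pow, div_mul_eq_mul_div, div_le_div_iff₀ (by positivity) h₂, mul_assoc]
    refine mul_le_mul_of_nonneg_left ?_ (by positivity)
    nlinarith [mul_nonneg hs h₂.le, mul_le_mul_of_nonneg_right hi h₂.le]
  · exact fun _ _ => rfl
  · refine fun D t _ y => Eventually.of_forall fun t' => ?_
    have hs : 0 ≤ ∑ i, (y i - mean u t' (D i)) ^ 2 := Finset.sum_nonneg fun _ _ => sq_nonneg _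
    rw [hlik]
    positivity
  · rintro D t _ y q rfl
    have hs : 0 ≤ ∑ i, (y i - mean u t (D i)) ^ 2 := Finset.sum_nonneg fun _ _ => sq_nonneg _
    refine exists_score_of_hasDerivAt u D y t
      (F := fun q => Real.log (K * (s₂ + q) ^ (-((s₁ + n) / 2))))
      (fun t' => by rw [hlik]) ?_
    set q := ∑ i, (y i - mean u t (D i)) ^ 2 with hq
    have hb : 0 < s₂ + q := by positivity
    have hd := (((hasDerivAt_id q).const_add s₂).rpow_const (p := -((s₁ + n) / 2))
      (Or.inl hb.ne')).const_mul K |>.log (by positivity)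
    convert! hd using 1
    simp only [id]
    rw [Real.rpow_sub_one hb.ne']
    have := Real.rpow_pos_of_pos hb (-((s₁ + n) / 2))
    field_simp

end Marginal

/-- In each treatment of the variance, the expected Fisher information gain is an increasing affine
function of the sum of squares of the model matrix. -/
theorem exists_affine_expectedFIG {n k p : ℕ} (u : Fin k → Fin p → ℕ) (S : Setting p)
    (hS : S.Valid) (Δ : Set (Fin n → Fin k → ℝ)) (hU : ∀ D ∈ Δ, S.HasExpectedFIG u D) :
    ∃ A B : ℝ, 0 < A ∧ ∀ D ∈ Δ, S.expectedFIG u D = A * sumSq u D + B := by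
  cases S with
  | known γ prior => exact exists_affine_known hS.1 hS.2 u Δ hU
  | nuisance s₁ s₂ prior => exact exists_affine_nuisance hS.1 hS.2.1 hS.2.2 u Δ hU
  | ofInterest prior => exact exists_affine_ofInterest hS.1 hS.2 u Δ hU

end FIG

namespace FIG

/-! ### Maximising `trace (XᵀX)` over the box and counting support points. -/

section Optimal

variable {n k p : ℕ} {a b : Fin k → ℝ}

theorem abs_regr (u : Fin k → Fin p → ℕ) (j : Fin p) (d : Fin k → ℝ) :
    |regr u j d| = regr u j fun r => |d r| := by
  simp [regr, Finset.abs_prod]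

theorem regr_le_regr (u : Fin k → Fin p → ℕ) (j : Fin p) {c d : Fin k → ℝ} (h0 : ∀ r, 0 ≤ c r)
    (h : ∀ r, c r ≤ d r) : regr u j c ≤ regr u j d :=
  Finset.prod_le_prod (fun r _ => pow_nonneg (h0 r) _)
    fun r _ => pow_le_pow_left₀ (h0 r) (h r) _

/-- The strict gain in the factor `r` survives multiplication because all other factors at `d` are
positive. -/
theorem regr_lt_regr (u : Fin k → Fin p → ℕ) (j : Fin p) {c d : Fin k → ℝ} (h0 : ∀ r, 0 ≤ c r)
    (h : ∀ r, c r ≤ d r) (hd : ∀ r, 0 < d r) {r : Fin k} (hr : c r < d r) (hu : u r j ≠ 0) :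
    regr u j c < regr u j d := by
  unfold regr
  rw [← Finset.mul_prod_erase _ _ (Finset.mem_univ r),
    ← Finset.mul_prod_erase _ _ (Finset.mem_univ r)]
  refine (mul_le_mul_of_nonneg_left (Finset.prod_le_prod (fun l _ => pow_nonneg (h0 l) _)
    fun l _ => pow_le_pow_left₀ (h0 l) (h l) _) (pow_nonneg (h0 r) _)).trans_lt ?_
  exact mul_lt_mul_of_pos_right (pow_lt_pow_left₀ hr (h0 r) hu)
    (Finset.prod_pos fun l _ => pow_pos (hd l) _)

theorem abs_le_max_of_mem_Icc {x y z : ℝ} (h : z ∈ Set.Icc x y) : |z| ≤ max |x| |y| :=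
  abs_le_max_abs_abs h.1 h.2

theorem regr_sq_le (u : Fin k → Fin p → ℕ) (j : Fin p) {d : Fin k → ℝ}
    (hd : ∀ r, d r ∈ Set.Icc (a r) (b r)) :
    regr u j d ^ 2 ≤ regr u j (fun r => max |a r| |b r|) ^ 2 := by
  rw [← sq_abs, abs_regr]
  exact pow_le_pow_left₀ (Finset.prod_nonneg fun r _ => pow_nonneg (abs_nonneg _) _)
    (regr_le_regr u j (fun r => abs_nonneg _) fun r => abs_le_max_of_mem_Icc (hd r)) 2

theorem sumSq_le (u : Fin k → Fin p → ℕ) {D : Fin n → Fin k → ℝ} (hD : D ∈ designs n a b) :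
    sumSq u D ≤ sumSq u fun (_ : Fin n) r => max |a r| |b r| :=
  Finset.sum_le_sum fun i _ => Finset.sum_le_sum fun j _ => regr_sq_le u j (hD i)

theorem sumSq_eq_of_abs_eq (u : Fin k → Fin p → ℕ) {D : Fin n → Fin k → ℝ}
    (hD : ∀ i r, |D i r| = max |a r| |b r|) :
    sumSq u D = sumSq u fun (_ : Fin n) r => max |a r| |b r| := by
  refine Finset.sum_congr rfl fun i _ => Finset.sum_congr rfl fun j _ => ?_
  rw [← sq_abs, abs_regr, funext (hD i)]

theorem max_abs_pos {x y : ℝ} (h : x < y) : 0 < max |x| |y| := by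
  by_contra hle
  have h' := not_lt.1 hle
  have hx := abs_nonpos_iff.1 ((le_max_left _ _).trans h')
  have hy := abs_nonpos_iff.1 ((le_max_right _ _).trans h')
  linarith

/-- A coordinate below its maximal modulus makes some monomial containing it strictly too small at
that run, and no other summand can compensate. Since `a r < b r`, all maximal moduli are positive,
as strictness requires. -/
theorem abs_eq_max_of_sumSq_le (hab : ∀ r, a r < b r) (u : Fin k → Fin p → ℕ)
    {D : Fin n → Fin k → ℝ} (hD : D ∈ designs n a b)
    (hle : (sumSq u fun (_ : Fin n) r => max |a r| |b r|) ≤ sumSq u D) (i : Fin n) {r : Fin k}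
    (hr : ∃ j, u r j ≠ 0) : |D i r| = max |a r| |b r| := by
  obtain ⟨j, hj⟩ := hr
  by_contra hne
  have hlt : |D i r| < max |a r| |b r| := lt_of_le_of_ne (abs_le_max_of_mem_Icc (hD i r)) hne
  refine absurd hle (not_le.2 ?_)
  refine Finset.sum_lt_sum
    (fun i _ => Finset.sum_le_sum fun j _ => regr_sq_le u j (hD i)) ⟨i, Finset.mem_univ i, ?_⟩
  refine Finset.sum_lt_sum (fun j _ => regr_sq_le u j (hD i)) ⟨j, Finset.mem_univ j, ?_⟩
  rw [← sq_abs, abs_regr]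
  exact pow_lt_pow_left₀ (regr_lt_regr u j (fun _ => abs_nonneg _)
    (fun r => abs_le_max_of_mem_Icc (hD i r)) (fun r => max_abs_pos (hab r)) hlt hj)
    (Finset.prod_nonneg fun r _ => pow_nonneg (abs_nonneg _) _) two_ne_zero

/-- The points of largest absolute value of the interval `[x, y]`. -/
noncomputable def extremes (x y : ℝ) : Finset ℝ :=
  if |x| = |y| then {x, y} else if |x| < |y| then {y} else {x}

theorem mem_extremes {x y z : ℝ} (h : x < y) :
    z ∈ extremes x y ↔ z ∈ Set.Icc x y ∧ |z| = max |x| |y| := by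
  unfold extremes
  split_ifs with h₁ h₂
  · rw [h₁, max_self, Finset.mem_insert, Finset.mem_singleton]
    constructor
    · rintro (rfl | rfl)
      · exact ⟨⟨le_rfl, h.le⟩, h₁⟩
      · exact ⟨⟨h.le, le_rfl⟩, rfl⟩
    · rintro ⟨-, hz⟩
      rcases abs_eq_abs.1 h₁ with h₃ | h₃
      · exact absurd h₃ h.ne
      · rcases abs_eq_abs.1 hz with h₄ | h₄
        · exact Or.inr h₄
        · exact Or.inl (h₄.trans h₃.symm)
  · rw [max_eq_right h₂.le, Finset.mem_singleton]
    constructor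
    · rintro rfl
      exact ⟨⟨h.le, le_rfl⟩, rfl⟩
    · rintro ⟨⟨h₃, h₃'⟩, hz⟩
      rcases abs_eq_abs.1 hz with h₄ | h₄
      · exact h₄
      -- The reflected point `-y` is outside the interval: below `x` if `y ≥ 0`, above `y` if `y <
      -- 0`.
      · have h₅ := neg_abs_le x
        rcases abs_cases y with h₆ | h₆ <;> linarith
  · have h₂' : |y| < |x| := lt_of_le_of_ne (not_lt.1 h₂) (Ne.symm h₁)
    rw [max_eq_left h₂'.le, Finset.mem_singleton]
    constructor
    · rintro rfl
      exact ⟨⟨le_rfl, h.le⟩, rfl⟩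
    · rintro ⟨⟨h₃, h₃'⟩, hz⟩
      rcases abs_eq_abs.1 hz with h₄ | h₄
      · exact h₄
      · have h₅ := le_abs_self y
        rcases abs_cases x with h₆ | h₆ <;> linarith

theorem card_extremes {x y : ℝ} (h : x < y) :
    (extremes x y).card = if |x| = |y| then 2 else 1 := by
  unfold extremes
  split_ifs
  · exact Finset.card_pair h.ne
  · exact Finset.card_singleton _
  · exact Finset.card_singleton _

theorem card_corners (hab : ∀ r, a r < b r) :
    (Fintype.piFinset fun r => extremes (a r) (b r)).card = 2 ^ numSymm a b := by
  rw [Fintype.card_piFinset, Finset.prod_congr rfl fun r _ => card_extremes (hab r),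
    Finset.prod_ite, Finset.prod_const, Finset.prod_const_one, mul_one, numSymm]

theorem mem_corners (hab : ∀ r, a r < b r) {d : Fin k → ℝ} :
    d ∈ Fintype.piFinset (fun r => extremes (a r) (b r)) ↔
      (∀ r, d r ∈ Set.Icc (a r) (b r)) ∧ ∀ r, |d r| = max |a r| |b r| := by
  simp only [Fintype.mem_piFinset, mem_extremes (hab _), forall_and]

theorem numSupport_le_of_abs_eq (hab : ∀ r, a r < b r) {D : Fin n → Fin k → ℝ}
    (hD : D ∈ designs n a b) (h : ∀ i r, |D i r| = max |a r| |b r|) :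
    numSupport D ≤ 2 ^ numSymm a b := by
  rw [← card_corners hab, ← Set.ncard_coe_finset]
  refine Set.ncard_le_ncard ?_ (Finset.finite_toSet _)
  rintro _ ⟨i, rfl⟩
  exact Finset.mem_coe.2 ((mem_corners hab).2 ⟨hD i, h i⟩)

theorem exists_range_eq_finset {α : Type*} (n : ℕ) (T : Finset α) (hT : T.card ≤ n)
    (hn : n ≠ 0 → T.Nonempty) : ∃ f : Fin n → α, Set.range f = T := by
  rcases eq_or_ne n 0 with rfl | h0
  · have : T = ∅ := Finset.card_eq_zero.1 (Nat.le_zero.1 hT)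
    exact ⟨Fin.elim0, by simp [this]⟩
  · obtain ⟨t, ht⟩ := hn h0
    have : Nonempty T := ⟨⟨t, ht⟩⟩
    -- A left inverse of an embedding `T ↪ Fin n` lists all points of `T` in `n` runs, with
    -- repetitions.
    obtain ⟨e⟩ : Nonempty (T ↪ Fin n) :=
      Function.Embedding.nonempty_of_card_le (by simpa using hT)
    exact ⟨Subtype.val ∘ Function.invFun e, by
      rw [(Function.invFun_surjective e.injective).range_comp]
      simp⟩

theorem exists_design_numSupport (hab : ∀ r, a r < b r) (n : ℕ) :
    ∃ D ∈ designs n a b, (∀ i r, |D i r| = max |a r| |b r|) ∧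
      numSupport D = min n (2 ^ numSymm a b) := by
  obtain ⟨T, hT, hcard⟩ := Finset.exists_subset_card_eq
    (s := Fintype.piFinset fun r => extremes (a r) (b r)) (n := min n (2 ^ numSymm a b))
    (by rw [card_corners hab]; exact min_le_right _ _)
  obtain ⟨D, hD⟩ := exists_range_eq_finset n T (hcard.le.trans (min_le_left _ _)) fun h0 => by
    rw [← Finset.card_pos, hcard]
    exact lt_min (Nat.pos_of_ne_zero h0) (by positivity)
  have hmem : ∀ i, D i ∈ Fintype.piFinset fun r => extremes (a r) (b r) := fun i =>
    hT (Finset.mem_coe.1 (hD ▸ Set.mem_range_self i))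
  refine ⟨D, fun i => ((mem_corners hab).1 (hmem i)).1,
    fun i => ((mem_corners hab).1 (hmem i)).2, ?_⟩
  rw [numSupport, hD, Set.ncard_coe_finset, hcard]

end Optimal

end FIG

theorem proposition1 (n k p : ℕ) (u : Fin k → Fin p → ℕ) (a b : Fin k → ℝ)
    (hab : ∀ r, a r < b r) (S : FIG.Setting p) (hS : S.Valid)
    (hU : ∀ D ∈ FIG.designs n a b, S.HasExpectedFIG u D) :
    -- designs with all coordinates of largest absolute value exist and are optimal
    ((∃ D ∈ FIG.designs n a b, ∀ i r, |D i r| = max |a r| |b r|) ∧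
      ∀ D ∈ FIG.designs n a b, (∀ i r, |D i r| = max |a r| |b r|) → FIG.IsOptimal S u a b D) ∧
    -- every optimal design has this form in each variable that occurs in the model
    (∀ D : Fin n → Fin k → ℝ, FIG.IsOptimal S u a b D →
      ∀ i r, (∃ j, u r j ≠ 0) → |D i r| = max |a r| |b r|) ∧
    -- the number of support points, when every variable occurs in the model
    ((∀ r, ∃ j, u r j ≠ 0) →
      (∀ D : Fin n → Fin k → ℝ, FIG.IsOptimal S u a b D →
        FIG.numSupport D ≤ 2 ^ FIG.numSymm a b) ∧
      (∃ D : Fin n → Fin k → ℝ, FIG.IsOptimal S u a b D ∧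
        FIG.numSupport D = min n (2 ^ FIG.numSymm a b)) ∧
      (2 ^ FIG.numSymm a b < p →
        ∀ D : Fin n → Fin k → ℝ, FIG.IsOptimal S u a b D → FIG.UnderSupported p D)) := by

  obtain ⟨A, B, hA, hAB⟩ := FIG.exists_affine_expectedFIG u S hS (FIG.designs n a b) hU
  obtain ⟨D₀, hD₀, hD₀abs, hD₀card⟩ := FIG.exists_design_numSupport hab n
  have hopt : ∀ D ∈ FIG.designs n a b, (∀ i r, |D i r| = max |a r| |b r|) →
      FIG.IsOptimal S u a b D := fun D hD h => ⟨hD, fun D' hD' => by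
    rw [hAB D hD, hAB D' hD', FIG.sumSq_eq_of_abs_eq u h]
    exact add_le_add_left (mul_le_mul_of_nonneg_left (FIG.sumSq_le u hD') hA.le) B⟩
  have habs : ∀ D : Fin n → Fin k → ℝ, FIG.IsOptimal S u a b D →
      ∀ i r, (∃ j, u r j ≠ 0) → |D i r| = max |a r| |b r| := fun D hD i r hr => by
    -- Comparison with the corner design `D₀`: `B` cancels and `A > 0`, so the trace of an optimal
    -- design reaches the upper bound.
    have hle := hD.2 D₀ hD₀
    rw [hAB D hD.1, hAB D₀ hD₀, FIG.sumSq_eq_of_abs_eq u hD₀abs] at hle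
    exact FIG.abs_eq_max_of_sumSq_le hab u hD.1
      (le_of_mul_le_mul_left (le_of_add_le_add_right hle) hA) i hr
  refine ⟨⟨⟨D₀, hD₀, hD₀abs⟩, hopt⟩, habs, fun hocc => ?_⟩
  have hsupp : ∀ D : Fin n → Fin k → ℝ, FIG.IsOptimal S u a b D →
      FIG.numSupport D ≤ 2 ^ FIG.numSymm a b := fun D hD =>
    FIG.numSupport_le_of_abs_eq hab hD.1 fun i r => habs D hD i r (hocc r)
  exact ⟨hsupp, ⟨D₀, hopt D₀ hD₀ hD₀abs, hD₀card⟩,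
    fun hp D hD => (hsupp D hD).trans_lt hp⟩
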